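/- Let $K$ be a field, let $n\ge t\ge 1$ be integers, and let $S=K[x_1,\dots,x_n]$ with the standard grading. A monomial $x_{i_1}\cdots x_{i_d}$ with $1\le i_1\le\dots\le i_d\le n$ is $t$-spread if $i_{j+1}-i_j\ge t$ for $j=1,\dots,d-1$; a $t$-spread ideal is an ideal of $S$ generated by $t$-spread monomials. For an ideal $I$ with minimal graded free resolution $\cdots\to F_1\to F_0\to I\to 0$, $F_i=\bigoplus_j S(-j)^{\beta_{i,j}(I)}$, the Castelnuovo–Mumford regularity is $\operatorname{reg}(I)=\max\{j-i:\beta_{i,j}(I)\ne 0\}$ (with $\operatorname{reg}(0)=-\infty$). (a) Every $t$-spread ideal $I$ of $S$ has a minimal graded free resolution, its regularity is well defined, and $$\operatorname{reg}(I)\le n-(t-1).$$ (b) The squarefree monomial ideals (the ideals generated by squarefree monomials) are exactly the $1$-spread ideals, and every such ideal $I$ satisfies Hochster's bound $\operatorname{reg}(I)\le n$. (c) For $i=1,\dots,t$ let $u_i=\prod_{1\le j\le n,\ j\equiv i\ (\mathrm{mod}\ t)}x_j$. These are $t$ distinct $t$-spread monomials whose supports $\{j : x_j \mid u_i\}$ are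 pairwise disjoint with union $\{1,\dots,n\}$, and the ideal $(u_1,\dots,u_t)$ they generate (the Pascal ideal of type $(n,t)$) is $t$-spread and attains the bound: $$\operatorname{reg}\big((u_1,\dots,u_t)\big)=n-(t-1).$$ -/

import Mathlib

open MvPolynomial

/-- A graded free resolution `⋯ → F₂ → F₁ → F₀ → I → 0` of an ideal `I` of
`S = K[x_1, …, x_n]` (standard grading) by finitely generated graded free modules.
The module `F i` is `S ^ (rank i)`, and its `b`-th standard basis vector has degree `deg i b`,
so that `F i = ⨁ b, S(- deg i b)`; all the maps are homogeneous of degree `0`. -/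
structure GradedFreeResolution {K : Type*} [Field K] {n : ℕ}
    (I : Ideal (MvPolynomial (Fin n) K)) where
  rank : ℕ → ℕ
  deg : (i : ℕ) → Fin (rank i) → ℤ
  /-- the differential `F (i + 1) → F i` -/
  d : (i : ℕ) → (Fin (rank (i + 1)) → MvPolynomial (Fin n) K) →ₗ[MvPolynomial (Fin n) K]
    (Fin (rank i) → MvPolynomial (Fin n) K)
  /-- the augmentation `F 0 → I` -/
  aug : (Fin (rank 0) → MvPolynomial (Fin n) K) →ₗ[MvPolynomial (Fin n) K] I
  /-- the entry of `d i` at `(c, b)` is zero or homogeneous of degree `deg b - deg c` -/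
  d_homogeneous : ∀ (i : ℕ) (b : Fin (rank (i + 1))) (c : Fin (rank i)),
    ∀ e ∈ (d i (Pi.single b 1) c).support, (e.degree : ℤ) = deg (i + 1) b - deg i c
  /-- the image of the `b`-th basis vector of `F 0` is zero or homogeneous of degree `deg b` -/
  aug_homogeneous : ∀ b : Fin (rank 0),
    ∀ e ∈ (aug (Pi.single b 1) : MvPolynomial (Fin n) K).support, (e.degree : ℤ) = deg 0 b
  exact_d : ∀ i : ℕ, Function.Exact (d (i + 1)) (d i)
  exact_aug : Function.Exact (d 0) aug
  aug_surjective : Function.Surjective aug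

/-- The resolution is minimal: the image of each differential `F (i + 1) → F i` lies in
`𝔪 F i`, where `𝔪 = (x_1, …, x_n)`. -/
def GradedFreeResolution.IsMinimal {K : Type*} [Field K] {n : ℕ}
    {I : Ideal (MvPolynomial (Fin n) K)} (F : GradedFreeResolution I) : Prop :=
  ∀ (i : ℕ) (v : Fin (F.rank (i + 1)) → MvPolynomial (Fin n) K) (c : Fin (F.rank i)),
    F.d i v c ∈ Ideal.span (Set.range (X : Fin n → MvPolynomial (Fin n) K))

/-- The number of summands `S(-j)` of `F i`. For a minimal resolution of `I` this is the graded
Betti number `β_{i,j}(I)`. -/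
def GradedFreeResolution.betti {K : Type*} [Field K] {n : ℕ}
    {I : Ideal (MvPolynomial (Fin n) K)} (F : GradedFreeResolution I) (i : ℕ) (j : ℤ) : ℕ :=
  (Finset.univ.filter fun b : Fin (F.rank i) => F.deg i b = j).card

/-- `HasRegularity I r`: the Castelnuovo–Mumford regularity
`reg I = max {j - i : β_{i,j}(I) ≠ 0}` is defined and equal to `r`; that is, `I` has a minimal
graded free resolution, and for every such resolution the maximum is `r`. In `WithBot ℤ` the least
upper bound of a nonempty set of integers is its maximum, and that of the empty set (the case of
the zero ideal) is `⊥`, i.e. `-∞`. -/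
def HasRegularity {K : Type*} [Field K] {n : ℕ}
    (I : Ideal (MvPolynomial (Fin n) K)) (r : WithBot ℤ) : Prop :=
  (∃ F : GradedFreeResolution I, F.IsMinimal) ∧
  ∀ F : GradedFreeResolution I, F.IsMinimal →
    IsLUB {x : WithBot ℤ | ∃ (i : ℕ) (j : ℤ), F.betti i j ≠ 0 ∧ x = ((j - (i : ℤ) : ℤ) : WithBot ℤ)}
      r

/-- A `t`-spread monomial: `x_{i_1} ⋯ x_{i_d}` with `i_1 ≤ ⋯ ≤ i_d` and `i_{j+1} - i_j ≥ t`
for all `j` (the case `d = 0`, the monomial `1`, is included). -/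
def IsSpreadMonomial {K : Type*} [Field K] {n : ℕ} (t : ℕ) (u : MvPolynomial (Fin n) K) : Prop :=
  ∃ (d : ℕ) (i : Fin d → Fin n), Monotone i ∧
    (∀ j k : Fin d, (k : ℕ) = (j : ℕ) + 1 → (i j : ℕ) + t ≤ (i k : ℕ)) ∧
    u = ∏ j, X (i j)

/-- A `t`-spread ideal: an ideal generated by `t`-spread monomials. -/
def IsSpreadIdeal {K : Type*} [Field K] {n : ℕ} (t : ℕ) (I : Ideal (MvPolynomial (Fin n) K)) :
    Prop :=
  ∃ G : Set (MvPolynomial (Fin n) K), (∀ u ∈ G, IsSpreadMonomial t u) ∧ I = Ideal.span G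

/-- A squarefree (monomial) ideal: an ideal generated by products of distinct variables. -/
def IsSquarefreeMonomialIdeal {K : Type*} [Field K] {n : ℕ}
    (I : Ideal (MvPolynomial (Fin n) K)) : Prop :=
  ∃ A : Set (Finset (Fin n)), I = Ideal.span ((fun s => ∏ j ∈ s, X j) '' A)

/-- The support of a monomial: the (indices of the) variables that divide it. -/
def monomialSupp {K : Type*} [Field K] {n : ℕ} (u : MvPolynomial (Fin n) K) : Set (Fin n) :=
  {j | X j ∣ u}

/-- The product of the variables whose index in `{1, …, n}` is congruent to `i` modulo `t`
(the element `j` of `Fin n` stands for the index `j + 1`). -/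
noncomputable def pascalMonomial (K : Type*) [Field K] (n t i : ℕ) : MvPolynomial (Fin n) K :=
  ∏ j ∈ Finset.univ.filter (fun j : Fin n => (j : ℕ) + 1 ≡ i [MOD t]), X j

/-- The generators of the Pascal ideal of type `(n, t)`. -/
def pascalGenerators (K : Type*) [Field K] (n t : ℕ) : Set (MvPolynomial (Fin n) K) :=
  pascalMonomial K n t '' Set.Icc 1 t

/-- The Pascal ideal of type `(n, t)`. -/
noncomputable def pascalIdeal (K : Type*) [Field K] (n t : ℕ) : Ideal (MvPolynomial (Fin n) K) :=
  Ideal.span (pascalGenerators K n t)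

/-! A `t`-spread ideal is generated by finitely many squarefree monomials, with supports `s k`.
Their Taylor complex is a graded free resolution: in homological degree `i` it has one basis vector
for every set `T` of `i + 1` generators, of degree the size of the union of the `s k`, `k ∈ T`. The
shifts of a minimal resolution occur in every graded free resolution
(`GradedFreeResolution.IsMinimal.betti_ne_zero`), so the regularity is at most the largest value of
(size of the union) `- (|T| - 1)`. A `t`-spread set meets the last `t` indices at most once, so the
union has at most `n - t + |T|` elements (`card_sup_le_of_isSpreadSet`), and the bound `n - (t - 1)`
follows.

The Pascal generators have nonempty, pairwise disjoint supports, so none divides the least common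
multiple of others and the Taylor resolution is minimal (`taylorResolution_isMinimal`). The set `T`
of all `t` generators has union of size `n` and attains the bound.

Regularity refers to minimal resolutions, so these must exist: minimal covers of iterated syzygies
are spliced together (`exists_minimal_gradedFreeResolution`). Finite length is not needed, since the
Taylor resolution bounds the shifts. Exactness of the Taylor complex is checked in each multidegree,
where it becomes the contractibility of a simplex (`exists_taylorMap_eq`). -/

/-! ### Homogeneous components of vectors over a polynomial ring -/

section HomogeneousParts

variable {σ K ι κ : Type*} [Field K]

open Classical in
/-- The sum of the terms of `p` whose exponent satisfies `P`. -/
noncomputable def monomialFilter (P : (σ →₀ ℕ) → Prop) (p : MvPolynomial σ K) :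
    MvPolynomial σ K :=
  ∑ e ∈ p.support with P e, monomial e (coeff e p)

open Classical in
theorem coeff_monomialFilter (P : (σ →₀ ℕ) → Prop) (p : MvPolynomial σ K) (e : σ →₀ ℕ) :
    coeff e (monomialFilter P p) = if P e then coeff e p else 0 := by
  rw [monomialFilter, coeff_sum]
  simp only [coeff_monomial]
  rw [Finset.sum_ite_eq']
  by_cases hP : P e <;> by_cases he : coeff e p = 0 <;> simp [hP, he]

/-- `v` is homogeneous of degree `j` in the free module whose `c`-th basis vector has degree
`deg c`. -/
def IsHomogVec (deg : ι → ℤ) (j : ℤ) (v : ι → MvPolynomial σ K) : Prop :=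
  ∀ c, ∀ e ∈ (v c).support, (e.degree : ℤ) = j - deg c

/-- The component of degree `j` of a vector of a graded free module. -/
noncomputable def homogPart (deg : ι → ℤ) (j : ℤ) (v : ι → MvPolynomial σ K) :
    ι → MvPolynomial σ K :=
  fun c => monomialFilter (fun e => (e.degree : ℤ) = j - deg c) (v c)

open Classical in
theorem coeff_homogPart (deg : ι → ℤ) (j : ℤ) (v : ι → MvPolynomial σ K) (c : ι)
    (e : σ →₀ ℕ) :
    coeff e (homogPart deg j v c) = if (e.degree : ℤ) = j - deg c then coeff e (v c) else 0 := by
  rw [homogPart, coeff_monomialFilter]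
  congr

theorem isHomogVec_homogPart (deg : ι → ℤ) (j : ℤ) (v : ι → MvPolynomial σ K) :
    IsHomogVec deg j (homogPart deg j v) := by
  classical
  intro c e he
  rw [mem_support_iff, coeff_homogPart] at he
  by_contra h
  simp [h] at he

theorem IsHomogVec.homogPart_eq {deg : ι → ℤ} {j : ℤ} {v : ι → MvPolynomial σ K}
    (hv : IsHomogVec deg j v) : homogPart deg j v = v := by
  classical
  ext c e
  rw [coeff_homogPart]
  split_ifs with h
  · rfl
  · by_contra h0
    exact h (hv c e (mem_support_iff.2 (Ne.symm h0)))

theorem homogPart_add (deg : ι → ℤ) (j : ℤ) (v w : ι → MvPolynomial σ K) :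
    homogPart deg j (v + w) = homogPart deg j v + homogPart deg j w := by
  classical
  ext c e
  simp only [coeff_homogPart, Pi.add_apply, coeff_add]
  split_ifs <;> simp

theorem homogPart_zero (deg : ι → ℤ) (j : ℤ) :
    homogPart deg j (0 : ι → MvPolynomial σ K) = 0 := by
  classical
  ext c e
  simp [coeff_homogPart]

theorem homogPart_sum {α : Type*} (deg : ι → ℤ) (j : ℤ) (s : Finset α)
    (v : α → ι → MvPolynomial σ K) :
    homogPart deg j (∑ a ∈ s, v a) = ∑ a ∈ s, homogPart deg j (v a) := by
  classical
  induction s using Finset.induction_on with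
  | empty => simp [homogPart_zero]
  | insert a s ha ih => rw [Finset.sum_insert ha, Finset.sum_insert ha, homogPart_add, ih]

/-- Homogeneous parts of a multiple of a homogeneous vector. -/
theorem IsHomogVec.homogPart_smul {deg : ι → ℤ} {k : ℤ} {v : ι → MvPolynomial σ K}
    (hv : IsHomogVec deg k v) (j : ℤ) (p : MvPolynomial σ K) :
    homogPart deg j (p • v) =
      monomialFilter (fun e => (e.degree : ℤ) = j - k) p • v := by
  classical
  ext c e
  simp only [coeff_homogPart, Pi.smul_apply, smul_eq_mul, coeff_mul]
  -- A term of `v c` has degree `k - deg c`, so fixing the degree of a product fixes that of the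
  -- factor from `p`.
  have key : ∀ x ∈ Finset.HasAntidiagonal.antidiagonal e, coeff x.2 (v c) ≠ 0 →
      (((x.1.degree : ℤ) = j - k) ↔ (e.degree : ℤ) = j - deg c) := by
    intro x hx h2
    have h3 := hv c x.2 (mem_support_iff.2 h2)
    have h4 : e.degree = x.1.degree + x.2.degree := by
      rw [← Finset.HasAntidiagonal.mem_antidiagonal.1 hx, map_add]
    push_cast [h4]
    constructor <;> intro h <;> linarith
  rw [← Finset.sum_const_zero (s := Finset.HasAntidiagonal.antidiagonal e), ← Finset.sum_ite_irrel]
  refine Finset.sum_congr rfl fun x hx => ?_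
  rw [coeff_monomialFilter]
  by_cases h2 : coeff x.2 (v c) = 0
  · simp [h2]
  · simp only [key x hx h2, ite_mul, zero_mul]

/-- Every vector is the sum of its homogeneous components. -/
theorem exists_sum_homogPart_eq [Finite ι] (deg : ι → ℤ) (v : ι → MvPolynomial σ K) :
    ∃ J : Finset ℤ, ∑ j ∈ J, homogPart deg j v = v := by
  classical
  cases nonempty_fintype ι
  refine ⟨Finset.univ.biUnion fun c => (v c).support.image fun e => (e.degree : ℤ) + deg c, ?_⟩
  ext c e
  rw [Finset.sum_apply, coeff_sum]
  simp only [coeff_homogPart]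
  have : ∀ j : ℤ, ((e.degree : ℤ) = j - deg c) = (j = (e.degree : ℤ) + deg c) := fun j => by
    rw [eq_iff_iff]; constructor <;> intro h <;> linarith
  simp only [this]
  rw [Finset.sum_ite_eq']
  split_ifs with h
  · rfl
  · by_contra h0
    refine h (Finset.mem_biUnion.2 ⟨c, Finset.mem_univ _, Finset.mem_image.2 ⟨e, ?_, rfl⟩⟩)
    exact mem_support_iff.2 (Ne.symm h0)

variable [Fintype ι] [DecidableEq ι]

/-- A linear map of free modules is determined by the images of the basis vectors. -/
theorem linearMap_eq_sum_single {M : Type*} [AddCommGroup M] [Module (MvPolynomial σ K) M]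
    (f : (ι → MvPolynomial σ K) →ₗ[MvPolynomial σ K] M) (v : ι → MvPolynomial σ K) :
    f v = ∑ b, v b • f (Pi.single b 1) := by
  conv_lhs => rw [pi_eq_sum_univ' v]
  simp [map_sum, map_smul]

/-- Homogeneous maps of degree zero commute with taking homogeneous components. -/
theorem homogPart_map {deg : ι → ℤ} {deg' : κ → ℤ}
    (f : (ι → MvPolynomial σ K) →ₗ[MvPolynomial σ K] (κ → MvPolynomial σ K))
    (hf : ∀ b, IsHomogVec deg' (deg b) (f (Pi.single b 1))) (j : ℤ)
    (v : ι → MvPolynomial σ K) :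
    homogPart deg' j (f v) = f (homogPart deg j v) := by
  rw [linearMap_eq_sum_single f v, linearMap_eq_sum_single f (homogPart deg j v),
    homogPart_sum]
  exact Finset.sum_congr rfl fun b _ => (hf b).homogPart_smul j (v b)

/-- Lifting a map out of a free module along `d`, with prescribed lifts of the basis vectors. -/
theorem exists_lift {M N : Type*} [AddCommGroup M] [Module (MvPolynomial σ K) M]
    [AddCommGroup N] [Module (MvPolynomial σ K) N]
    (d : M →ₗ[MvPolynomial σ K] N) (φ : (ι → MvPolynomial σ K) →ₗ[MvPolynomial σ K] N)
    (P : ι → M → Prop) (h : ∀ b, ∃ w, d w = φ (Pi.single b 1) ∧ P b w) :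
    ∃ f : (ι → MvPolynomial σ K) →ₗ[MvPolynomial σ K] M,
      (∀ v, d (f v) = φ v) ∧ ∀ b, P b (f (Pi.single b 1)) := by
  choose w hw hP using h
  have hf : ∀ b, (Pi.basisFun (MvPolynomial σ K) ι).constr (MvPolynomial σ K) w
      (Pi.single b 1) = w b := fun b => by
    rw [← Pi.basisFun_apply, Module.Basis.constr_basis]
  refine ⟨(Pi.basisFun (MvPolynomial σ K) ι).constr (MvPolynomial σ K) w, fun v => ?_,
    fun b => by rw [hf]; exact hP b⟩
  rw [linearMap_eq_sum_single _ v, linearMap_eq_sum_single φ v, map_sum]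
  exact Finset.sum_congr rfl fun b _ => by rw [map_smul, hf, hw]

end HomogeneousParts

/-! ### Comparison of a minimal resolution with an arbitrary one -/

/-- The ideal generated by all the variables consists of the polynomials without constant term. -/
theorem mem_span_range_X_iff {σ K : Type*} [Field K] {p : MvPolynomial σ K} :
    p ∈ Ideal.span (Set.range (X : σ → MvPolynomial σ K)) ↔ coeff 0 p = 0 := by
  rw [← Set.image_univ, mem_ideal_span_X_image]
  constructor
  · intro h
    by_contra h0
    obtain ⟨i, -, hi⟩ := h 0 (mem_support_iff.2 h0)
    exact hi rfl
  · intro h m hm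
    have hm0 : m ≠ 0 := by
      rintro rfl
      exact (mem_support_iff.1 hm) h
    obtain ⟨i, hi⟩ := Finsupp.ne_iff.1 hm0
    exact ⟨i, Set.mem_univ _, hi⟩

/-- A linear map of free modules preserves the vectors with entries in `𝔪`. -/
theorem map_mem_span_range_X {σ K ι κ : Type*} [Field K] [Fintype ι] [DecidableEq ι]
    (f : (ι → MvPolynomial σ K) →ₗ[MvPolynomial σ K] (κ → MvPolynomial σ K))
    {v : ι → MvPolynomial σ K}
    (hv : ∀ b, v b ∈ Ideal.span (Set.range (X : σ → MvPolynomial σ K))) (c : κ) :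
    f v c ∈ Ideal.span (Set.range (X : σ → MvPolynomial σ K)) := by
  rw [linearMap_eq_sum_single f v, Finset.sum_apply]
  exact Ideal.sum_mem _ fun b _ => Ideal.mul_mem_right _ _ (hv b)

section Comparison

variable {K : Type*} [Field K] {n : ℕ} {I : Ideal (MvPolynomial (Fin n) K)}

local notation "𝔪" => Ideal.span (Set.range (X : Fin n → MvPolynomial (Fin n) K))

/-- The degree `i` parts of chain maps `f : F → G`, `g : G → F` lifting the identity, with `f`
homogeneous, and of a homotopy from `g ∘ f` to the identity that is trivial modulo `𝔪`. -/
structure ComparisonStage (F G : GradedFreeResolution I) (i : ℕ) where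
  f : (Fin (F.rank i) → MvPolynomial (Fin n) K) →ₗ[MvPolynomial (Fin n) K]
    (Fin (G.rank i) → MvPolynomial (Fin n) K)
  g : (Fin (G.rank i) → MvPolynomial (Fin n) K) →ₗ[MvPolynomial (Fin n) K]
    (Fin (F.rank i) → MvPolynomial (Fin n) K)
  s : (Fin (F.rank i) → MvPolynomial (Fin n) K) →ₗ[MvPolynomial (Fin n) K]
    (Fin (F.rank (i + 1)) → MvPolynomial (Fin n) K)
  f_homogeneous : ∀ b, IsHomogVec (G.deg i) (F.deg i b) (f (Pi.single b 1))
  f_range : ∀ v, ∃ w, G.d i w = f (F.d i v)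
  g_range : ∀ v, ∃ w, F.d i w = g (G.d i v)
  homotopy : ∀ v, F.d i (s (F.d i v)) = g (f (F.d i v)) - F.d i v
  sub_mem : ∀ b c, g (f (Pi.single b 1)) c -
    (Pi.single b 1 : Fin (F.rank i) → MvPolynomial (Fin n) K) c ∈ 𝔪

theorem GradedFreeResolution.d_isHomogVec (F : GradedFreeResolution I) (i : ℕ)
    (b : Fin (F.rank (i + 1))) :
    IsHomogVec (F.deg i) (F.deg (i + 1) b) (F.d i (Pi.single b 1)) :=
  fun c e he => F.d_homogeneous i b c e he

/-- The identity of `I` lifts through both augmentations, and taking homogeneous components of the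
lifts makes `f` homogeneous. Then `g ∘ f - id` factors through `F.d 0`, whose image lies in `𝔪` by
minimality. -/
theorem ComparisonStage.nonempty_zero (F G : GradedFreeResolution I) (hF : F.IsMinimal) :
    Nonempty (ComparisonStage F G 0) := by
  have augHom : ∀ (H : GradedFreeResolution I) (b : Fin (H.rank 0)),
      IsHomogVec (fun _ : Unit => (0 : ℤ)) (H.deg 0 b)
        (fun _ => (H.aug (Pi.single b 1) : MvPolynomial (Fin n) K)) := fun H b _ e he => by
    rw [sub_zero]; exact H.aug_homogeneous b e he
  -- Viewing `I` inside a free module of rank one, with basis in degree 0, makes `homogPart_map`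
  -- applicable to the augmentation.
  let toPi : I →ₗ[MvPolynomial (Fin n) K] (Unit → MvPolynomial (Fin n) K) :=
    LinearMap.pi fun _ => I.subtype
  obtain ⟨f, hf, hfh⟩ := exists_lift G.aug F.aug
    (fun b w => IsHomogVec (G.deg 0) (F.deg 0 b) w) (fun b => by
      obtain ⟨w, hw⟩ := G.aug_surjective (F.aug (Pi.single b 1))
      refine ⟨homogPart (G.deg 0) (F.deg 0 b) w, ?_, isHomogVec_homogPart _ _ _⟩
      have h1 := homogPart_map (deg' := fun _ : Unit => (0 : ℤ)) (toPi ∘ₗ G.aug)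
        (augHom G) (F.deg 0 b) w
      have h2 : (toPi ∘ₗ G.aug) w = fun _ => (F.aug (Pi.single b 1) : MvPolynomial (Fin n) K) := by
        ext1 x; simp [toPi, hw]
      rw [h2, (augHom F b).homogPart_eq] at h1
      exact Subtype.ext (congrFun h1 ()).symm)
  obtain ⟨g, hg, -⟩ := exists_lift F.aug G.aug (fun _ _ => True) (fun b => by
    obtain ⟨w, hw⟩ := F.aug_surjective (G.aug (Pi.single b 1))
    exact ⟨w, hw, trivial⟩)
  obtain ⟨s, hs, -⟩ := exists_lift (F.d 0) (g ∘ₗ f - LinearMap.id) (fun _ _ => True) (fun b => by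
    obtain ⟨w, hw⟩ := (F.exact_aug ((g ∘ₗ f - LinearMap.id : _ →ₗ[_] _) (Pi.single b 1))).1
      (by simp [map_sub, hg, hf])
    exact ⟨w, hw, trivial⟩)
  exact ⟨{
    f := f
    g := g
    s := s
    f_homogeneous := hfh
    f_range := fun v => (G.exact_aug _).1 (by
      rw [hf]; exact (F.exact_aug _).2 ⟨v, rfl⟩)
    g_range := fun v => (F.exact_aug _).1 (by
      rw [hg]; exact (G.exact_aug _).2 ⟨v, rfl⟩)
    homotopy := fun v => by rw [hs]; rfl
    sub_mem := fun b c => by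
      have := hF 0 (s (Pi.single b 1)) c
      rw [hs] at this
      exact this }⟩

/-- The new maps satisfy `g f - 1 = d s + C.s d`. Both terms on the right vanish modulo `𝔪` because
`F` is minimal; neither minimality of `G` nor homogeneity of `g` plays a role. -/
theorem ComparisonStage.nonempty_succ {F G : GradedFreeResolution I} (hF : F.IsMinimal) {i : ℕ}
    (C : ComparisonStage F G i) : Nonempty (ComparisonStage F G (i + 1)) := by
  obtain ⟨f, hf, hfh⟩ := exists_lift (G.d i) (C.f ∘ₗ F.d i)
    (fun b w => IsHomogVec (G.deg (i + 1)) (F.deg (i + 1) b) w) (fun b => by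
      obtain ⟨w, hw⟩ := C.f_range (Pi.single b 1)
      refine ⟨homogPart (G.deg (i + 1)) (F.deg (i + 1) b) w, ?_, isHomogVec_homogPart _ _ _⟩
      rw [← homogPart_map (G.d i) (G.d_isHomogVec i), hw, homogPart_map C.f C.f_homogeneous,
        (F.d_isHomogVec i b).homogPart_eq]
      rfl)
  obtain ⟨g, hg, -⟩ := exists_lift (F.d i) (C.g ∘ₗ G.d i) (fun _ _ => True) (fun b => by
    obtain ⟨w, hw⟩ := C.g_range (Pi.single b 1)
    exact ⟨w, hw, trivial⟩)
  obtain ⟨s, hs, -⟩ := exists_lift (F.d (i + 1)) (g ∘ₗ f - LinearMap.id - C.s ∘ₗ F.d i)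
    (fun _ _ => True) (fun b => by
      obtain ⟨w, hw⟩ := (F.exact_d i ((g ∘ₗ f - LinearMap.id - C.s ∘ₗ F.d i : _ →ₗ[_] _)
        (Pi.single b 1))).1 (by
          simp only [LinearMap.sub_apply, LinearMap.comp_apply, LinearMap.id_apply, map_sub, hg,
            hf, C.homotopy]
          simp)
      exact ⟨w, hw, trivial⟩)
  have hFdd : ∀ v, F.d i (F.d (i + 1) v) = 0 := fun v => (F.exact_d i _).2 ⟨v, rfl⟩
  have hGdd : ∀ v, G.d i (G.d (i + 1) v) = 0 := fun v => (G.exact_d i _).2 ⟨v, rfl⟩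
  exact ⟨{
    f := f
    g := g
    s := s
    f_homogeneous := hfh
    f_range := fun v => (G.exact_d i _).1 (by simp [hf, hFdd])
    g_range := fun v => (F.exact_d i _).1 (by simp [hg, hGdd])
    homotopy := fun v => by rw [hs]; simp [hFdd]
    sub_mem := fun b c => by
      have h1 := hF (i + 1) (s (Pi.single b 1)) c
      have h2 := map_mem_span_range_X C.s (hF i (Pi.single b 1)) c
      have h3 := Ideal.add_mem _ h1 h2
      rw [hs] at h3
      simpa using h3 }⟩

/-- The shifts of a minimal resolution occur in every graded free resolution. -/
theorem GradedFreeResolution.IsMinimal.betti_ne_zero {F : GradedFreeResolution I}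
    (hF : F.IsMinimal) (G : GradedFreeResolution I) {i : ℕ} {j : ℤ} (h : F.betti i j ≠ 0) :
    G.betti i j ≠ 0 := by
  have hC : Nonempty (ComparisonStage F G i) := by
    clear h
    induction i with
    | zero => exact ComparisonStage.nonempty_zero F G hF
    | succ i ih => exact ih.elim fun C => C.nonempty_succ hF
  obtain ⟨C⟩ := hC
  obtain ⟨b, hb⟩ := Finset.card_pos.1 (Nat.pos_of_ne_zero h)
  have hbj : F.deg i b = j := (Finset.mem_filter.1 hb).2
  intro hG
  have hdeg : ∀ c, G.deg i c ≠ j := fun c hc =>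
    Finset.notMem_empty c ((Finset.card_eq_zero.1 hG) ▸
      Finset.mem_filter.2 ⟨Finset.mem_univ _, hc⟩)
  -- A constant entry of `C.f (Pi.single b 1)` would need a basis vector of degree `j` in `G`.
  -- Without one, `g f` sends this basis vector into `𝔪`, although it is the identity modulo `𝔪`.
  have h1 : ∀ c, C.f (Pi.single b 1) c ∈ 𝔪 := fun c => by
    rw [mem_span_range_X_iff]
    by_contra h0
    have := C.f_homogeneous b c 0 (mem_support_iff.2 h0)
    rw [hbj, map_zero] at this
    exact hdeg c (by push_cast at this; linarith)
  have h2 := Ideal.sub_mem _ (map_mem_span_range_X C.g h1 b) (C.sub_mem b b)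
  rw [mem_span_range_X_iff] at h2
  simp at h2

end Comparison

/-! ### Existence of minimal graded free resolutions -/

section MinimalResolution

variable {K : Type*} [Field K] {n : ℕ}

/-- A homogeneous submodule of a free module with a homogeneous basis of prescribed degrees. -/
structure GradedFreeSubmodule (n : ℕ) (K : Type*) [Field K] where
  rank : ℕ
  deg : Fin rank → ℤ
  carrier : Submodule (MvPolynomial (Fin n) K) (Fin rank → MvPolynomial (Fin n) K)
  homogPart_mem : ∀ v ∈ carrier, ∀ j, homogPart deg j v ∈ carrier

/-- A homogeneous submodule is generated by finitely many homogeneous vectors. -/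
theorem GradedFreeSubmodule.exists_generators (N : GradedFreeSubmodule n K) :
    ∃ (k : ℕ) (w : Fin k → Fin N.rank → MvPolynomial (Fin n) K) (e : Fin k → ℤ),
      (∀ b, IsHomogVec N.deg (e b) (w b)) ∧
      Submodule.span (MvPolynomial (Fin n) K) (Set.range w) = N.carrier := by
  let A : Set (Fin N.rank → MvPolynomial (Fin n) K) :=
    {w | w ∈ N.carrier ∧ ∃ j, IsHomogVec N.deg j w}
  have hA : Submodule.span (MvPolynomial (Fin n) K) A = N.carrier := by
    refine le_antisymm (Submodule.span_le.2 fun w hw => hw.1) fun v hv => ?_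
    obtain ⟨J, hJ⟩ := exists_sum_homogPart_eq N.deg v
    rw [← hJ]
    exact Submodule.sum_mem _ fun j _ => Submodule.subset_span
      ⟨N.homogPart_mem v hv j, j, isHomogVec_homogPart _ _ _⟩
  obtain ⟨T, hTA, hT⟩ := (Submodule.fg_span_iff_fg_span_finset_subset A).1
    (IsNoetherian.noetherian (R := MvPolynomial (Fin n) K) _)
  have hTe : ∀ b : Fin T.card, ∃ j, IsHomogVec N.deg j
      (T.equivFin.symm b : Fin N.rank → MvPolynomial (Fin n) K) :=
    fun b => (hTA (T.equivFin.symm b).2).2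
  choose e he using hTe
  refine ⟨T.card, fun b => T.equivFin.symm b, e, he, ?_⟩
  rw [← hA, hT]
  congr 1
  ext x
  constructor
  · rintro ⟨b, rfl⟩
    exact (T.equivFin.symm b).2
  · intro hx
    exact ⟨T.equivFin ⟨x, hx⟩, by simp⟩

/-- Coefficients of relations between minimally many homogeneous generators lie in `𝔪`. -/
theorem coeff_zero_eq_zero_of_relation {r k : ℕ} {deg : Fin r → ℤ}
    {w : Fin k → Fin r → MvPolynomial (Fin n) K} {e : Fin k → ℤ}
    (hw : ∀ b, IsHomogVec deg (e b) (w b))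
    (hmin : ∀ b, w b ∉ Submodule.span (MvPolynomial (Fin n) K) (w '' {b}ᶜ))
    {v : Fin k → MvPolynomial (Fin n) K} (hv : ∑ b, v b • w b = 0) (b : Fin k) :
    coeff 0 (v b) = 0 := by
  classical
  by_contra h0
  -- In the degree of `w b` the coefficient of `w b` reduces to its constant term; if this is
  -- nonzero, `w b` is a combination of the other generators.
  have h1 := congrArg (homogPart deg (e b)) hv
  rw [homogPart_sum, homogPart_zero] at h1
  simp only [(hw _).homogPart_smul] at h1
  have h2 : monomialFilter (fun x => (x.degree : ℤ) = e b - e b) (v b) =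
      C (coeff 0 (v b)) := by
    ext x
    rw [coeff_monomialFilter, coeff_C]
    have : ((x.degree : ℤ) = e b - e b) ↔ 0 = x := by
      rw [sub_self, Nat.cast_eq_zero, Finsupp.degree_eq_zero_iff, eq_comm]
    simp only [this]
    split_ifs with h
    · rw [h]
    · rfl
  rw [← Finset.add_sum_erase _ _ (Finset.mem_univ b), h2] at h1
  have h3 : (C (coeff 0 (v b)) : MvPolynomial (Fin n) K) • w b ∈
      Submodule.span (MvPolynomial (Fin n) K) (w '' {b}ᶜ) := by
    rw [eq_neg_of_add_eq_zero_left h1]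
    refine Submodule.neg_mem _ (Submodule.sum_mem _ fun c hc => Submodule.smul_mem _ _
      (Submodule.subset_span ⟨c, ?_, rfl⟩))
    exact (Finset.mem_erase.1 hc).1
  have h4 := Submodule.smul_mem _ (C (coeff 0 (v b))⁻¹) h3
  rw [smul_smul, ← C_mul, inv_mul_cancel₀ h0, C_1, one_smul] at h4
  exact hmin b h4

/-- A homogeneous submodule is the image of a homogeneous map from a graded free module, with
kernel contained in `𝔪` times this module. -/
theorem GradedFreeSubmodule.exists_minimal_cover (N : GradedFreeSubmodule n K) :
    ∃ (k : ℕ) (e : Fin k → ℤ) (d : (Fin k → MvPolynomial (Fin n) K) →ₗ[MvPolynomial (Fin n) K]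
        (Fin N.rank → MvPolynomial (Fin n) K)),
      (∀ b, IsHomogVec N.deg (e b) (d (Pi.single b 1))) ∧ LinearMap.range d = N.carrier ∧
      ∀ v, d v = 0 → ∀ b, coeff 0 (v b) = 0 := by
  classical
  -- The number of homogeneous generators is chosen least possible, so that none can be dropped.
  have hex := N.exists_generators
  obtain ⟨w, e, hw, hspan⟩ := Nat.find_spec hex
  have hlt := fun {m} => Nat.find_min hex (m := m)
  generalize Nat.find hex = k at w e hw hspan hlt
  refine ⟨k, e, Fintype.linearCombination _ w, fun b => ?_, ?_, fun v hv => ?_⟩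
  · rw [Fintype.linearCombination_apply_single, one_smul]; exact hw b
  · rw [Fintype.range_linearCombination, hspan]
  · rw [Fintype.linearCombination_apply] at hv
    refine coeff_zero_eq_zero_of_relation hw (fun b hb => ?_) hv
    cases k with
    | zero => exact b.elim0
    | succ k =>
      refine hlt (Nat.lt_succ_self k) ⟨w ∘ b.succAbove, e ∘ b.succAbove, fun c => hw _, ?_⟩
      rw [← hspan, Set.range_comp, Fin.range_succAbove]
      refine le_antisymm (Submodule.span_mono (Set.image_subset_range _ _))
        (Submodule.span_le.2 ?_)
      rintro _ ⟨c, rfl⟩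
      by_cases hc : c = b
      · rw [hc]; exact hb
      · exact Submodule.subset_span ⟨c, hc, rfl⟩

/-- The kernel of a homogeneous map is homogeneous. -/
theorem homogPart_mem_ker {r k : ℕ} {deg : Fin r → ℤ} {e : Fin k → ℤ}
    {d : (Fin k → MvPolynomial (Fin n) K) →ₗ[MvPolynomial (Fin n) K]
      (Fin r → MvPolynomial (Fin n) K)}
    (hd : ∀ b, IsHomogVec deg (e b) (d (Pi.single b 1))) {v} (hv : v ∈ LinearMap.ker d) (j : ℤ) :
    homogPart e j v ∈ LinearMap.ker d := by
  rw [LinearMap.mem_ker] at hv ⊢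
  rw [← homogPart_map d hd, hv, homogPart_zero]

/-- The rank of a minimal cover of a homogeneous submodule. -/
noncomputable def GradedFreeSubmodule.coverRank (N : GradedFreeSubmodule n K) : ℕ :=
  N.exists_minimal_cover.choose

/-- The degrees of the basis of a minimal cover of a homogeneous submodule. -/
noncomputable def GradedFreeSubmodule.coverDeg (N : GradedFreeSubmodule n K) :
    Fin N.coverRank → ℤ :=
  N.exists_minimal_cover.choose_spec.choose

/-- A minimal cover of a homogeneous submodule. -/
noncomputable def GradedFreeSubmodule.cover (N : GradedFreeSubmodule n K) :
    (Fin N.coverRank → MvPolynomial (Fin n) K) →ₗ[MvPolynomial (Fin n) K]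
      (Fin N.rank → MvPolynomial (Fin n) K) :=
  N.exists_minimal_cover.choose_spec.choose_spec.choose

theorem GradedFreeSubmodule.cover_isHomogVec (N : GradedFreeSubmodule n K) (b) :
    IsHomogVec N.deg (N.coverDeg b) (N.cover (Pi.single b 1)) :=
  N.exists_minimal_cover.choose_spec.choose_spec.choose_spec.1 b

theorem GradedFreeSubmodule.range_cover (N : GradedFreeSubmodule n K) :
    LinearMap.range N.cover = N.carrier :=
  N.exists_minimal_cover.choose_spec.choose_spec.choose_spec.2.1

theorem GradedFreeSubmodule.coeff_zero_of_cover_eq_zero (N : GradedFreeSubmodule n K) {v}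
    (hv : N.cover v = 0) (b) : coeff 0 (v b) = 0 :=
  N.exists_minimal_cover.choose_spec.choose_spec.choose_spec.2.2 v hv b

/-- The first syzygies of a homogeneous submodule. -/
noncomputable def GradedFreeSubmodule.syzygies (N : GradedFreeSubmodule n K) :
    GradedFreeSubmodule n K where
  rank := N.coverRank
  deg := N.coverDeg
  carrier := LinearMap.ker N.cover
  homogPart_mem _ hv j := homogPart_mem_ker N.cover_isHomogVec hv j

/-- The `i`-th syzygies of a homogeneous submodule. -/
noncomputable def GradedFreeSubmodule.iterSyzygies (N : GradedFreeSubmodule n K) :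
    ℕ → GradedFreeSubmodule n K
  | 0 => N
  | i + 1 => (N.iterSyzygies i).syzygies

/-- A homogeneous ideal as a submodule of the free module of rank one. -/
noncomputable def GradedFreeSubmodule.ofIdeal (I : Ideal (MvPolynomial (Fin n) K))
    (hI : ∀ p ∈ I, ∀ j : ℤ, monomialFilter (fun e => (e.degree : ℤ) = j) p ∈ I) :
    GradedFreeSubmodule n K where
  rank := 1
  deg _ := 0
  carrier := Submodule.comap (LinearMap.proj (0 : Fin 1) :
    (Fin 1 → MvPolynomial (Fin n) K) →ₗ[MvPolynomial (Fin n) K] MvPolynomial (Fin n) K) I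
  homogPart_mem v hv j := by
    have := hI (v 0) hv j
    rw [Submodule.mem_comap]
    change monomialFilter (fun e => (e.degree : ℤ) = j - 0) (v 0) ∈ I
    rwa [sub_zero]

/-- Every homogeneous ideal has a minimal graded free resolution. -/
theorem exists_minimal_gradedFreeResolution (I : Ideal (MvPolynomial (Fin n) K))
    (hI : ∀ p ∈ I, ∀ j : ℤ, monomialFilter (fun e => (e.degree : ℤ) = j) p ∈ I) :
    ∃ F : GradedFreeResolution I, F.IsMinimal := by
  let N := (GradedFreeSubmodule.ofIdeal I hI).iterSyzygies
  let cover₀ : (Fin (N 0).coverRank → MvPolynomial (Fin n) K) →ₗ[MvPolynomial (Fin n) K]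
    (Fin 1 → MvPolynomial (Fin n) K) := (N 0).cover
  have hN : ∀ v, cover₀ v 0 ∈ I := fun v => by
    have h : (N 0).cover v ∈ (N 0).carrier := by
      rw [← GradedFreeSubmodule.range_cover]; exact ⟨v, rfl⟩
    exact h
  let aug : (Fin (N 0).coverRank → MvPolynomial (Fin n) K) →ₗ[MvPolynomial (Fin n) K] I :=
    LinearMap.codRestrict I (LinearMap.proj 0 ∘ₗ cover₀) hN
  have ker_aug : ∀ v, aug v = 0 ↔ cover₀ v = 0 := fun v => by
    constructor
    · intro h
      funext x
      have : x = 0 := Subsingleton.elim (α := Fin 1) _ _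
      rw [this]
      exact congrArg Subtype.val h
    · intro h
      exact Subtype.ext (congrFun h 0)
  have exact_cover : ∀ i v, (N i).cover v = 0 ↔ v ∈ Set.range (N (i + 1)).cover := fun i v => by
    rw [← LinearMap.coe_range, GradedFreeSubmodule.range_cover]
    rfl
  refine ⟨{
    rank := fun i => (N i).coverRank
    deg := fun i => (N i).coverDeg
    d := fun i => (N (i + 1)).cover
    aug := aug
    d_homogeneous := fun i b c e he => (N (i + 1)).cover_isHomogVec b c e he
    aug_homogeneous := fun b e he => by
      have := (N 0).cover_isHomogVec b (0 : Fin 1) e he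
      rwa [show (N 0).deg (0 : Fin 1) = 0 from rfl, sub_zero] at this
    exact_d := fun i v => exact_cover (i + 1) v
    exact_aug := fun v => (ker_aug v).trans (exact_cover 0 v)
    aug_surjective := fun p => by
      have h : (fun _ => (p : MvPolynomial (Fin n) K)) ∈ LinearMap.range (N 0).cover := by
        rw [GradedFreeSubmodule.range_cover]
        exact p.2
      obtain ⟨v, hv⟩ := h
      exact ⟨v, Subtype.ext (congrFun hv (0 : Fin 1))⟩ }, ?_⟩
  -- The image of `d i` is the kernel of the minimal cover of `N i`, whose vectors have no constant
  -- terms.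
  intro i v c
  rw [mem_span_range_X_iff]
  exact (N i).coeff_zero_of_cover_eq_zero ((exact_cover i _).2 ⟨v, rfl⟩) c

end MinimalResolution

/-! ### Contractibility of the augmented chain complex of a simplex -/

section Simplex

variable {α K : Type*} [LinearOrder α] [Field K]

/-- The sign of the face `U` in the boundary of the face `U ∪ {k}`. -/
def faceSign (K : Type*) [Field K] (k : α) (U : Finset α) : K :=
  (-1) ^ (U.filter (· < k)).card

theorem faceSign_mul_self (k : α) (U : Finset α) : faceSign K k U * faceSign K k U = 1 := by
  rw [faceSign, ← mul_pow]; simp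

theorem faceSign_insert {k g : α} {U : Finset α} (hg : g ∉ U) :
    faceSign K k (insert g U) = (if g < k then -1 else 1) * faceSign K k U := by
  unfold faceSign
  rw [Finset.filter_insert]
  split_ifs
  · rw [Finset.card_insert_of_notMem (fun h => hg (Finset.mem_filter.1 h).1), pow_succ, mul_comm]
  · rw [one_mul]

/-- Exactly one of `g < k` and `k < g` holds, so exactly one of the two factors changes sign. -/
theorem faceSign_insert_mul_faceSign_insert {k g : α} {U : Finset α} (hk : k ∉ U) (hg : g ∉ U)
    (h : k ≠ g) :
    faceSign K k (insert g U) * faceSign K g (insert k U) =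
      -(faceSign K k U * faceSign K g U) := by
  rw [faceSign_insert hk, faceSign_insert hg]
  rcases lt_or_gt_of_ne h with h | h <;> simp [h, h.not_gt]

theorem faceSign_mul_faceSign_insert {k g : α} {U : Finset α} (hk : k ∉ U) (hg : g ∉ U)
    (h : k ≠ g) :
    faceSign K k U * faceSign K g (insert k U) + faceSign K g U * faceSign K k (insert g U) = 0 := by
  rw [faceSign_insert hk, faceSign_insert hg]
  rcases lt_or_gt_of_ne h with h | h <;> simp [h, h.not_gt] <;> ring

variable [Fintype α]

/-- The boundary of a simplicial chain of a simplex, in terms of coefficients. -/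
def simplexBoundary (x : Finset α → K) (U : Finset α) : K :=
  ∑ k ∈ Uᶜ, faceSign K k U * x (insert k U)

/-- Adjoining two vertices in either order gives the same face with opposite signs, so the terms
cancel in pairs. -/
theorem simplexBoundary_simplexBoundary (x : Finset α → K) (V : Finset α) :
    simplexBoundary (simplexBoundary x) V = 0 := by
  unfold simplexBoundary
  simp only [Finset.mul_sum]
  rw [Finset.sum_sigma']
  refine Finset.sum_involution (fun p _ => ⟨p.2, p.1⟩) ?_ ?_ ?_ ?_
  · rintro ⟨k, l⟩ h
    simp only [Finset.mem_sigma, Finset.mem_compl, Finset.mem_insert, not_or] at h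
    dsimp only
    rw [Finset.insert_comm k l, ← mul_assoc, ← mul_assoc, ← add_mul,
      faceSign_mul_faceSign_insert h.1 h.2.2 (Ne.symm h.2.1), zero_mul]
  · rintro ⟨k, l⟩ h - heq
    simp only [Finset.mem_sigma, Finset.mem_compl, Finset.mem_insert, not_or] at h
    exact h.2.1 (congrArg Sigma.fst heq)
  · rintro ⟨k, l⟩ h
    simp only [Finset.mem_sigma, Finset.mem_compl, Finset.mem_insert, not_or] at h ⊢
    exact ⟨h.2.2, Ne.symm h.2.1, h.1⟩
  · rintro ⟨k, l⟩ h
    rfl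

/-- Coning a cycle from a vertex `g` gives a chain with this cycle as boundary. -/
theorem simplexBoundary_cone {x : Finset α → K} (hx : ∀ U, simplexBoundary x U = 0) (g : α)
    (U : Finset α) :
    simplexBoundary (fun T => if g ∈ T then faceSign K g (T.erase g) * x (T.erase g) else 0) U =
      x U := by
  unfold simplexBoundary
  by_cases hg : g ∈ U
  · obtain ⟨V, hV, rfl⟩ : ∃ V, g ∉ V ∧ U = insert g V :=
      ⟨U.erase g, Finset.notMem_erase _ _, (Finset.insert_erase hg).symm⟩
    -- The cycle condition at `V` expresses `x (insert g V)` through the faces `insert k V` with `k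
    -- ≠ g`, which are those that the cone sees.
    have h := hx V
    unfold simplexBoundary at h
    rw [← Finset.insert_erase (Finset.mem_compl.2 hV),
      Finset.sum_insert (Finset.notMem_erase _ _), ← Finset.compl_insert] at h
    have h2 : ∀ k ∈ (insert g V)ᶜ, faceSign K k (insert g V) *
        (if g ∈ insert k (insert g V) then faceSign K g ((insert k (insert g V)).erase g) *
          x ((insert k (insert g V)).erase g) else 0) =
        -faceSign K g V * (faceSign K k V * x (insert k V)) := by
      intro k hk
      simp only [Finset.mem_compl, Finset.mem_insert, not_or] at hk
      have h3 : (insert k (insert g V)).erase g = insert k V := by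
        rw [Finset.insert_comm, Finset.erase_insert]
        simp [Ne.symm hk.1, hV]
      rw [if_pos (by simp), h3, ← mul_assoc, faceSign_insert_mul_faceSign_insert hk.2 hV hk.1]
      ring
    rw [Finset.sum_congr rfl h2, ← Finset.mul_sum, eq_neg_of_add_eq_zero_right h, neg_mul_neg,
      ← mul_assoc, faceSign_mul_self, one_mul]
  · rw [Finset.sum_eq_single_of_mem g (Finset.mem_compl.2 hg)]
    · dsimp only
      rw [if_pos (Finset.mem_insert_self _ _), Finset.erase_insert hg, ← mul_assoc,
        faceSign_mul_self, one_mul]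
    · intro k _ hkg
      dsimp only
      rw [if_neg, mul_zero]
      simp [Ne.symm hkg, hg]

end Simplex

/-! ### The Taylor complex and its multigraded strands -/

section Taylor

set_option linter.unusedSectionVars false

variable {α σ K : Type*} [LinearOrder α] [Fintype α] [Field K] (u : α → σ →₀ ℕ)

/-- The differential of the Taylor complex of the monomials with exponents `u`; the basis vector
indexed by `T` corresponds to the least common multiple of the `u k`, `k ∈ T`. -/
noncomputable def taylorMap (K : Type*) [Field K] :
    (Finset α → MvPolynomial σ K) →ₗ[MvPolynomial σ K] (Finset α → MvPolynomial σ K) :=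
  LinearMap.pi fun U => ∑ k ∈ Uᶜ,
    monomial ((insert k U).sup u - U.sup u) (faceSign K k U) • LinearMap.proj (insert k U)

variable {u}

theorem taylorMap_apply (c : Finset α → MvPolynomial σ K) (U : Finset α) :
    taylorMap u K c U =
      ∑ k ∈ Uᶜ, monomial ((insert k U).sup u - U.sup u) (faceSign K k U) * c (insert k U) := by
  simp [taylorMap]

theorem taylorMap_apply_congr {c c' : Finset α → MvPolynomial σ K} {U : Finset α}
    (h : ∀ T, T.card = U.card + 1 → c T = c' T) : taylorMap u K c U = taylorMap u K c' U := by
  rw [taylorMap_apply, taylorMap_apply]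
  refine Finset.sum_congr rfl fun k hk => ?_
  rw [h _ (Finset.card_insert_of_notMem (Finset.mem_compl.1 hk))]

variable (u) in
open Classical in
/-- The coefficients of `c` in multidegree `a`. -/
noncomputable def taylorStrand (a : σ →₀ ℕ) (c : Finset α → MvPolynomial σ K) (T : Finset α) : K :=
  if T.sup u ≤ a then coeff (a - T.sup u) (c T) else 0

theorem ext_taylorStrand {c c' : Finset α → MvPolynomial σ K}
    (h : ∀ a T, taylorStrand u a c T = taylorStrand u a c' T) : c = c' := by
  ext T e
  have := h (e + T.sup u) T
  simpa [taylorStrand] using this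

/-- The monomial entries of the differential only shift exponents to keep the multidegree `a`, so
only the signs remain. This reduces exactness to the simplex. -/
theorem taylorStrand_taylorMap (a : σ →₀ ℕ) (c : Finset α → MvPolynomial σ K) :
    taylorStrand u a (taylorMap u K c) = simplexBoundary (taylorStrand u a c) := by
  classical
  funext U
  unfold taylorStrand simplexBoundary
  have hsub : ∀ k, U.sup u ≤ (insert k U).sup u :=
    fun k => Finset.sup_mono (Finset.subset_insert _ _)
  split_ifs with h
  · rw [taylorMap_apply, coeff_sum]
    refine Finset.sum_congr rfl fun k _ => ?_
    rw [coeff_monomial_mul']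
    have h1 : (insert k U).sup u - U.sup u ≤ a - U.sup u ↔ (insert k U).sup u ≤ a := by
      rw [tsub_le_iff_right, tsub_add_cancel_of_le h]
    have h2 : a - U.sup u - ((insert k U).sup u - U.sup u) = a - (insert k U).sup u := by
      rw [tsub_tsub, add_tsub_cancel_of_le (hsub k)]
    simp only [h1, h2, mul_ite, mul_zero]
  · refine (Finset.sum_eq_zero fun k _ => ?_).symm
    dsimp only
    rw [if_neg (fun h' => h ((hsub k).trans h')), mul_zero]

theorem taylorMap_taylorMap (c : Finset α → MvPolynomial σ K) :
    taylorMap u K (taylorMap u K c) = 0 := by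
  refine ext_taylorStrand (u := u) fun a T => ?_
  rw [taylorStrand_taylorMap, taylorStrand_taylorMap, simplexBoundary_simplexBoundary]
  simp [taylorStrand]

variable (u) in
open Classical in
/-- Some `u g` dividing the monomial with exponent `a`, if there is one. -/
noncomputable def taylorApex (a : σ →₀ ℕ) : Option α :=
  if h : ∃ g, u g ≤ a then some h.choose else none

theorem le_of_taylorApex {a : σ →₀ ℕ} {g : α} (h : taylorApex u a = some g) : u g ≤ a := by
  unfold taylorApex at h
  split_ifs at h with h'
  rw [Option.some_inj] at h
  exact h ▸ h'.choose_spec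

theorem exists_taylorApex {a : σ →₀ ℕ} (h : ∃ g, u g ≤ a) : ∃ g, taylorApex u a = some g := by
  unfold taylorApex
  rw [dif_pos h]
  exact ⟨_, rfl⟩

variable (u) in
/-- In each multidegree, the cone over `c` from `taylorApex`. -/
noncomputable def taylorCone (c : Finset α → MvPolynomial σ K) (T : Finset α) :
    MvPolynomial σ K :=
  ∑ g ∈ T, C (faceSign K g (T.erase g)) *
    monomialFilter (fun e => taylorApex u (e + T.sup u) = some g)
      (divMonomial (c (T.erase g)) (T.sup u - (T.erase g).sup u))

/-- An exponent `e` in the entry at `T` has multidegree `e + T.sup u`; the filter thus selects the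
apex belonging to `a`, the same for all `T`. -/
theorem taylorStrand_taylorCone (c : Finset α → MvPolynomial σ K) {a : σ →₀ ℕ} {g : α}
    (hg : taylorApex u a = some g) :
    taylorStrand u a (taylorCone u c) = fun T =>
      if g ∈ T then faceSign K g (T.erase g) * taylorStrand u a c (T.erase g) else 0 := by
  classical
  funext T
  have hsub : (T.erase g).sup u ≤ T.sup u := Finset.sup_mono (Finset.erase_subset _ _)
  by_cases hT : T.sup u ≤ a
  · rw [taylorStrand, if_pos hT, taylorCone, coeff_sum]
    simp only [coeff_C_mul, coeff_monomialFilter, tsub_add_cancel_of_le hT, hg, Option.some_inj,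
      coeff_divMonomial, mul_ite, mul_zero]
    rw [Finset.sum_ite_eq]
    refine if_congr Iff.rfl ?_ rfl
    rw [taylorStrand, if_pos (hsub.trans hT), add_comm, tsub_add_tsub_cancel hT hsub]
  · rw [taylorStrand, if_neg hT]
    split_ifs with hgT
    · rw [taylorStrand, if_neg, mul_zero]
      -- Since `u g ≤ a`, adjoining `g` to a face cannot destroy divisibility.
      intro h
      apply hT
      rw [← Finset.insert_erase hgT, Finset.sup_insert]
      exact sup_le (le_of_taylorApex hg) h
    · rfl

/-- The Taylor complex is exact in the multidegrees that are divisible by some `u g`. -/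
theorem exists_taylorMap_eq {c : Finset α → MvPolynomial σ K} (hc : taylorMap u K c = 0)
    (hapex : ∀ a T, taylorStrand u a c T ≠ 0 → ∃ g, u g ≤ a) : ∃ b, taylorMap u K b = c := by
  have hcyc : ∀ a U, simplexBoundary (taylorStrand u a c) U = 0 := fun a U => by
    rw [← taylorStrand_taylorMap, hc]
    simp [taylorStrand]
  refine ⟨taylorCone u c, ext_taylorStrand (u := u) fun a T => ?_⟩
  rw [taylorStrand_taylorMap]
  by_cases h : ∃ g, u g ≤ a
  · obtain ⟨g, hg⟩ := exists_taylorApex h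
    rw [taylorStrand_taylorCone c hg, simplexBoundary_cone (hcyc a)]
  -- If no generator divides the monomial of exponent `a`, both sides vanish: `c` by `hapex`, the
  -- boundary because it only involves nonempty faces.
  · have h0 : taylorStrand u a c T = 0 := by
      by_contra h'
      exact h (hapex a T h')
    rw [h0]
    refine Finset.sum_eq_zero fun k _ => ?_
    rw [taylorStrand, if_neg, mul_zero]
    intro h'
    exact h ⟨k, (Finset.le_sup (f := u) (Finset.mem_insert_self k T)).trans h'⟩

/-- A nonempty face contributes only in multidegrees divisible by its own vertices, so the empty
face is the sole obstruction to coning. -/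
theorem exists_taylorMap_eq_of_apply_empty {c : Finset α → MvPolynomial σ K}
    (hc : taylorMap u K c = 0) (h0 : c ∅ = 0) : ∃ b, taylorMap u K b = c := by
  refine exists_taylorMap_eq hc fun a T hT => ?_
  rcases T.eq_empty_or_nonempty with rfl | ⟨k, hk⟩
  · simp [taylorStrand, h0] at hT
  · refine ⟨k, (Finset.le_sup (f := u) hk).trans ?_⟩
    by_contra h
    simp [taylorStrand, h] at hT

/-- The ideal generated by the monomials with exponents `u`. -/
noncomputable def monomialSpan (u : α → σ →₀ ℕ) (K : Type*) [Field K] :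
    Ideal (MvPolynomial σ K) :=
  Ideal.span ((fun e => monomial e (1 : K)) '' Set.range u)

theorem mem_monomialSpan_iff {p : MvPolynomial σ K} :
    p ∈ monomialSpan u K ↔ ∀ e ∈ p.support, ∃ g, u g ≤ e := by
  rw [monomialSpan, mem_ideal_span_monomial_image]
  simp

theorem exists_taylorMap_eq_single {p : MvPolynomial σ K} (hp : p ∈ monomialSpan u K) :
    ∃ b, taylorMap u K b = Pi.single ∅ p := by
  refine exists_taylorMap_eq ?_ fun a T hT => ?_
  · funext U
    rw [taylorMap_apply]
    exact Finset.sum_eq_zero fun k _ => by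
      rw [Pi.single_eq_of_ne (Finset.insert_ne_empty k U), mul_zero]
  · by_cases hT' : T = ∅
    · subst hT'
      refine mem_monomialSpan_iff.1 hp a (mem_support_iff.2 ?_)
      simpa [taylorStrand, bot_eq_zero] using hT
    · simp [taylorStrand, Pi.single_eq_of_ne hT'] at hT

theorem taylorMap_apply_empty_mem (c : Finset α → MvPolynomial σ K) :
    taylorMap u K c ∅ ∈ monomialSpan u K := by
  rw [taylorMap_apply]
  refine Ideal.sum_mem _ fun k _ => Ideal.mul_mem_right _ _ ?_
  rw [mem_monomialSpan_iff]
  intro e he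
  refine ⟨k, ?_⟩
  have := support_monomial_subset he
  rw [Finset.mem_singleton] at this
  simp [this, bot_eq_zero]

theorem mem_support_taylorMap_single {T U : Finset α} {e : σ →₀ ℕ}
    (he : e ∈ (taylorMap u K (Pi.single T 1) U).support) :
    U.sup u ≤ T.sup u ∧ e = T.sup u - U.sup u := by
  classical
  rw [taylorMap_apply] at he
  obtain ⟨k, -, hk⟩ := Finset.mem_biUnion.1 (support_sum he)
  by_cases h : insert k U = T
  · rw [h, Pi.single_eq_same, mul_one] at hk
    refine ⟨?_, Finset.mem_singleton.1 (support_monomial_subset hk)⟩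
    rw [← h]
    exact Finset.sup_mono (Finset.subset_insert _ _)
  · rw [Pi.single_eq_of_ne h, mul_zero] at hk
    simp at hk

theorem degree_of_mem_support_taylorMap_single {T U : Finset α} {e : σ →₀ ℕ}
    (he : e ∈ (taylorMap u K (Pi.single T 1) U).support) :
    (e.degree : ℤ) = ((T.sup u).degree : ℤ) - ((U.sup u).degree : ℤ) := by
  obtain ⟨h1, h2⟩ := mem_support_taylorMap_single he
  rw [eq_sub_iff_add_eq, ← Nat.cast_add, ← map_add, h2, tsub_add_cancel_of_le h1]

end Taylor

/-! ### The Taylor resolution and the bound on the regularity -/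

section TaylorResolution

set_option linter.unusedSectionVars false

variable {α K : Type*} [LinearOrder α] [Fintype α] [Field K] {n : ℕ} (u : α → Fin n →₀ ℕ)

/-- An enumeration of the `i`-dimensional faces of the simplex with vertices `α`. -/
noncomputable def simplexFace (α : Type*) [Fintype α] (i : ℕ)
    (b : Fin ((Finset.univ : Finset α).powersetCard (i + 1)).card) : Finset α :=
  (((Finset.univ : Finset α).powersetCard (i + 1)).equivFin.symm b).1

theorem simplexFace_injective (i : ℕ) : Function.Injective (simplexFace α i) :=
  Subtype.val_injective.comp (Equiv.injective _)

theorem card_simplexFace {i : ℕ} (b) : (simplexFace α i b).card = i + 1 :=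
  (Finset.mem_powersetCard.1 (Subtype.property _)).2

theorem exists_simplexFace_eq {i : ℕ} {T : Finset α} (hT : T.card = i + 1) :
    ∃ b, simplexFace α i b = T :=
  ⟨Finset.equivFin _ ⟨T, Finset.mem_powersetCard.2 ⟨Finset.subset_univ _, hT⟩⟩, by
    simp [simplexFace]⟩

/-- Extension of a vector indexed by the `i`-dimensional faces by zero. -/
noncomputable def faceExtend (α K : Type*) [Fintype α] [Field K] (n i : ℕ) :
    (Fin ((Finset.univ : Finset α).powersetCard (i + 1)).card → MvPolynomial (Fin n) K)
      →ₗ[MvPolynomial (Fin n) K] (Finset α → MvPolynomial (Fin n) K) :=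
  Function.ExtendByZero.linearMap _ (simplexFace α i)

theorem faceExtend_apply_simplexFace {i : ℕ} (v) (b) :
    faceExtend α K n i v (simplexFace α i b) = v b :=
  (simplexFace_injective i).extend_apply _ _ _

theorem faceExtend_apply_of_card_ne {i : ℕ} (v) {T : Finset α} (hT : T.card ≠ i + 1) :
    faceExtend α K n i v T = 0 :=
  Function.extend_apply' _ _ _ fun ⟨b, hb⟩ => hT (hb ▸ card_simplexFace b)

theorem faceExtend_comp_simplexFace {i : ℕ} {c : Finset α → MvPolynomial (Fin n) K}
    {T : Finset α} (hT : T.card = i + 1) :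
    faceExtend α K n i (fun b => c (simplexFace α i b)) T = c T := by
  obtain ⟨b, rfl⟩ := exists_simplexFace_eq hT
  rw [faceExtend_apply_simplexFace]

theorem faceExtend_single {i : ℕ} (b) :
    faceExtend α K n i (Pi.single b 1) = Pi.single (simplexFace α i b) 1 := by
  funext T
  by_cases hT : T.card = i + 1
  · obtain ⟨b', rfl⟩ := exists_simplexFace_eq hT
    rw [faceExtend_apply_simplexFace]
    by_cases h : b' = b
    · subst h; simp
    · rw [Pi.single_eq_of_ne h, Pi.single_eq_of_ne ((simplexFace_injective i).ne h)]
  · rw [faceExtend_apply_of_card_ne _ hT, Pi.single_eq_of_ne]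
    rintro rfl
    exact hT (card_simplexFace b)

/-- The differentials of the Taylor complex. -/
noncomputable def taylorDifferential (K : Type*) [Field K] (i : ℕ) :
    (Fin ((Finset.univ : Finset α).powersetCard (i + 1 + 1)).card → MvPolynomial (Fin n) K)
      →ₗ[MvPolynomial (Fin n) K]
    (Fin ((Finset.univ : Finset α).powersetCard (i + 1)).card → MvPolynomial (Fin n) K) :=
  LinearMap.funLeft _ _ (simplexFace α i) ∘ₗ taylorMap u K ∘ₗ faceExtend α K n (i + 1)

/-- The augmentation of the Taylor complex. -/
noncomputable def taylorAugmentation (K : Type*) [Field K] :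
    (Fin ((Finset.univ : Finset α).powersetCard (0 + 1)).card → MvPolynomial (Fin n) K)
      →ₗ[MvPolynomial (Fin n) K] monomialSpan u K :=
  LinearMap.codRestrict (monomialSpan u K)
    (LinearMap.proj ∅ ∘ₗ taylorMap u K ∘ₗ faceExtend α K n 0)
    fun _ => taylorMap_apply_empty_mem _

variable {u}

theorem taylorDifferential_apply {i : ℕ} (v) (b) :
    taylorDifferential u K i v b =
      taylorMap u K (faceExtend α K n (i + 1) v) (simplexFace α i b) := rfl

theorem coe_taylorAugmentation (v) :
    (taylorAugmentation u K v : MvPolynomial (Fin n) K) =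
      taylorMap u K (faceExtend α K n 0 v) ∅ := rfl

theorem taylorMap_faceExtend_of_card_ne {i : ℕ} (v) {U : Finset α} (hU : U.card ≠ i) :
    taylorMap u K (faceExtend α K n i v) U = 0 := by
  rw [taylorMap_apply_congr (c' := 0), map_zero, Pi.zero_apply]
  intro T hT
  exact faceExtend_apply_of_card_ne v (by omega)

theorem faceExtend_taylorDifferential {i : ℕ} (v) :
    faceExtend α K n i (taylorDifferential u K i v) =
      taylorMap u K (faceExtend α K n (i + 1) v) := by
  funext T
  by_cases hT : T.card = i + 1
  · exact faceExtend_comp_simplexFace (c := taylorMap u K (faceExtend α K n (i + 1) v)) hT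
  · rw [faceExtend_apply_of_card_ne _ hT, taylorMap_faceExtend_of_card_ne v hT]

/-- A preimage under the full Taylor map may involve faces of every size; the map lowers sizes by
one, so its part on faces with `i + 2` vertices suffices. -/
theorem exists_taylorDifferential_eq {i : ℕ} {v}
    (hv : taylorMap u K (faceExtend α K n i v) = 0) : ∃ w, taylorDifferential u K i w = v := by
  obtain ⟨b, hb⟩ := exists_taylorMap_eq_of_apply_empty hv
    (faceExtend_apply_of_card_ne v (by simp))
  refine ⟨fun x => b (simplexFace α (i + 1) x), ?_⟩
  funext x
  rw [taylorDifferential_apply, ← faceExtend_apply_simplexFace v x, ← hb]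
  refine taylorMap_apply_congr fun T hT => faceExtend_comp_simplexFace ?_
  rw [hT, card_simplexFace]

theorem exact_taylorDifferential (i : ℕ) :
    Function.Exact (taylorDifferential u K (i + 1)) (taylorDifferential u K i) := by
  intro v
  constructor
  · intro hv
    refine exists_taylorDifferential_eq ?_
    rw [← faceExtend_taylorDifferential, hv, map_zero]
  · rintro ⟨w, rfl⟩
    funext x
    rw [taylorDifferential_apply, faceExtend_taylorDifferential, taylorMap_taylorMap]
    rfl

theorem exact_taylorAugmentation :
    Function.Exact (taylorDifferential u K 0) (taylorAugmentation u K) := by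
  intro v
  constructor
  · intro hv
    refine exists_taylorDifferential_eq ?_
    funext U
    by_cases hU : U.card = 0
    · rw [Finset.card_eq_zero.1 hU, ← coe_taylorAugmentation, hv]
      rfl
    · exact taylorMap_faceExtend_of_card_ne v hU
  · rintro ⟨w, rfl⟩
    refine Subtype.ext ?_
    rw [coe_taylorAugmentation, faceExtend_taylorDifferential, taylorMap_taylorMap]
    rfl

theorem taylorAugmentation_surjective : Function.Surjective (taylorAugmentation u K) := by
  rintro ⟨p, hp⟩
  obtain ⟨b, hb⟩ := exists_taylorMap_eq_single hp
  refine ⟨fun x => b (simplexFace α 0 x), Subtype.ext ?_⟩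
  rw [coe_taylorAugmentation]
  have : taylorMap u K b ∅ = p := by rw [hb, Pi.single_eq_same]
  refine Eq.trans ?_ this
  exact taylorMap_apply_congr fun T hT => faceExtend_comp_simplexFace (by rw [hT]; rfl)

variable (u) in
/-- The Taylor resolution of the ideal generated by the monomials with exponents `u`. -/
noncomputable def taylorResolution (K : Type*) [Field K] :
    GradedFreeResolution (monomialSpan u K) where
  -- The ideal, not its quotient, is resolved: vertices sit in homological degree 0, and the empty
  -- face receives the augmentation.
  rank i := ((Finset.univ : Finset α).powersetCard (i + 1)).card
  deg i b := (((simplexFace α i b).sup u).degree : ℤ)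
  d := taylorDifferential u K
  aug := taylorAugmentation u K
  d_homogeneous i b c e he := by
    rw [taylorDifferential_apply, faceExtend_single] at he
    exact degree_of_mem_support_taylorMap_single he
  aug_homogeneous b e he := by
    rw [coe_taylorAugmentation, faceExtend_single] at he
    rw [degree_of_mem_support_taylorMap_single he]
    simp [bot_eq_zero]
  exact_d := exact_taylorDifferential
  exact_aug := exact_taylorAugmentation
  aug_surjective := taylorAugmentation_surjective

theorem betti_taylorResolution_ne_zero_iff {i : ℕ} {j : ℤ} :
    (taylorResolution u K).betti i j ≠ 0 ↔
      ∃ T : Finset α, T.card = i + 1 ∧ ((T.sup u).degree : ℤ) = j := by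
  rw [GradedFreeResolution.betti, Finset.card_ne_zero]
  constructor
  · rintro ⟨b, hb⟩
    exact ⟨simplexFace α i b, card_simplexFace b, (Finset.mem_filter.1 hb).2⟩
  · rintro ⟨T, hT, hj⟩
    obtain ⟨b, rfl⟩ := exists_simplexFace_eq hT
    exact ⟨b, Finset.mem_filter.2 ⟨Finset.mem_univ _, hj⟩⟩

/-- The Taylor resolution is minimal if no generator divides the least common multiple of other
generators. -/
theorem taylorResolution_isMinimal
    (h : ∀ (T : Finset α) (k : α), k ∉ T → ¬ u k ≤ T.sup u) :
    (taylorResolution u K).IsMinimal := by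
  intro i v c
  change taylorMap u K (faceExtend α K n (i + 1) v) (simplexFace α i c) ∈ _
  rw [taylorMap_apply]
  refine Ideal.sum_mem _ fun k hk => Ideal.mul_mem_right _ _ ?_
  rw [mem_span_range_X_iff, coeff_monomial, if_neg]
  -- A nonzero constant entry would force the two least common multiples to agree, so `u k` would
  -- divide the smaller one.
  intro h0
  refine h _ k (Finset.mem_compl.1 hk) ?_
  rw [tsub_eq_zero_iff_le, Finset.sup_insert] at h0
  exact le_sup_left.trans h0

theorem monomialFilter_mem_monomialSpan {p : MvPolynomial (Fin n) K} (hp : p ∈ monomialSpan u K)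
    (P : (Fin n →₀ ℕ) → Prop) : monomialFilter P p ∈ monomialSpan u K := by
  classical
  rw [mem_monomialSpan_iff] at hp ⊢
  intro e he
  refine hp e (mem_support_iff.2 fun h => ?_)
  rw [mem_support_iff, coeff_monomialFilter, h] at he
  simp at he

/-- The regularity of a monomial ideal is defined, and bounded by any bound for the Taylor
resolution. -/
theorem exists_hasRegularity_le {B : ℤ}
    (hB : ∀ T : Finset α, T.Nonempty → ((T.sup u).degree : ℤ) - (T.card - 1) ≤ B) :
    ∃ r : WithBot ℤ, HasRegularity (monomialSpan u K) r ∧ r ≤ (B : WithBot ℤ) := by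
  obtain ⟨F, hF⟩ := exists_minimal_gradedFreeResolution (monomialSpan u K)
    fun p hp j => monomialFilter_mem_monomialSpan hp _
  let A : Set ℤ := {x | ∃ (i : ℕ) (j : ℤ), F.betti i j ≠ 0 ∧ x = j - (i : ℤ)}
  have hA : ∀ x ∈ A, x ≤ B := by
    rintro x ⟨i, j, hij, rfl⟩
    obtain ⟨T, hT, rfl⟩ := betti_taylorResolution_ne_zero_iff.1
      (hF.betti_ne_zero (taylorResolution u K) hij)
    have := hB T (Finset.card_pos.1 (by omega))
    rw [hT] at this
    push_cast at this
    linarith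
  -- Comparing in both directions, all minimal resolutions have the same shifts.
  have hset : ∀ G : GradedFreeResolution (monomialSpan u K), G.IsMinimal →
      {x : WithBot ℤ | ∃ (i : ℕ) (j : ℤ), G.betti i j ≠ 0 ∧
        x = ((j - (i : ℤ) : ℤ) : WithBot ℤ)} = (fun x : ℤ => (x : WithBot ℤ)) '' A := by
    intro G hG
    ext x
    constructor
    · rintro ⟨i, j, hij, rfl⟩
      exact ⟨_, ⟨i, j, hG.betti_ne_zero F hij, rfl⟩, rfl⟩
    · rintro ⟨_, ⟨i, j, hij, rfl⟩, rfl⟩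
      exact ⟨i, j, hF.betti_ne_zero G hij, rfl⟩
  suffices ∃ r : WithBot ℤ, IsLUB ((fun x : ℤ => (x : WithBot ℤ)) '' A) r ∧ r ≤ (B : WithBot ℤ) by
    obtain ⟨r, hr, hrB⟩ := this
    exact ⟨r, ⟨⟨F, hF⟩, fun G hG => by rw [hset G hG]; exact hr⟩, hrB⟩
  rcases A.eq_empty_or_nonempty with hA0 | hA0
  · exact ⟨⊥, by rw [hA0, Set.image_empty]; exact isLUB_empty, bot_le⟩
  · obtain ⟨m, hm, hmax⟩ := Int.exists_greatest_of_bdd ⟨B, hA⟩ hA0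
    refine ⟨m, IsGreatest.isLUB ⟨⟨m, hm, rfl⟩, ?_⟩, WithBot.coe_le_coe.2 (hA m hm)⟩
    rintro _ ⟨x, hx, rfl⟩
    exact WithBot.coe_le_coe.2 (hmax x hx)

/-- A monomial ideal with minimal Taylor resolution has the regularity of this resolution. -/
theorem hasRegularity_of_forall_not_le {B : ℤ}
    (h : ∀ (T : Finset α) (k : α), k ∉ T → ¬ u k ≤ T.sup u)
    (hB : ∀ T : Finset α, T.Nonempty → ((T.sup u).degree : ℤ) - (T.card - 1) ≤ B)
    {T : Finset α} (hT : T.Nonempty) (hTB : ((T.sup u).degree : ℤ) - (T.card - 1) = B) :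
    HasRegularity (monomialSpan u K) (B : WithBot ℤ) := by
  have hmin := taylorResolution_isMinimal (K := K) h
  obtain ⟨r, hr, hrB⟩ := exists_hasRegularity_le (K := K) hB
  have hcard : T.card = T.card - 1 + 1 := (Nat.succ_pred_eq_of_pos hT.card_pos).symm
  have : (B : WithBot ℤ) ≤ r := (hr.2 _ hmin).1 ⟨T.card - 1, ((T.sup u).degree : ℤ),
    betti_taylorResolution_ne_zero_iff.2 ⟨T, hcard, rfl⟩, by
      rw [← hTB, Nat.cast_sub hT.card_pos, Nat.cast_one]⟩
  rwa [le_antisymm hrB this] at hr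

end TaylorResolution

/-! ### Squarefree monomials as finite sets -/

section Squarefree

variable {K : Type*} [Field K] {n : ℕ}

/-- The exponent of the product of the variables in `s`. -/
noncomputable def squarefreeExponent (s : Finset (Fin n)) : Fin n →₀ ℕ :=
  Finsupp.equivFunOnFinite.symm fun j => if j ∈ s then 1 else 0

theorem squarefreeExponent_apply (s : Finset (Fin n)) (j : Fin n) :
    squarefreeExponent s j = if j ∈ s then 1 else 0 := rfl

theorem squarefreeExponent_le_iff {s s' : Finset (Fin n)} :
    squarefreeExponent s ≤ squarefreeExponent s' ↔ s ⊆ s' := by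
  constructor
  · intro h j hj
    by_contra hj'
    have := h j
    simp [squarefreeExponent_apply, hj, hj'] at this
  · intro h j
    rw [squarefreeExponent_apply, squarefreeExponent_apply]
    split_ifs with h1 h2
    · exact le_rfl
    · exact absurd (h h1) h2
    · exact zero_le_one
    · exact le_rfl

theorem degree_squarefreeExponent (s : Finset (Fin n)) : (squarefreeExponent s).degree = s.card := by
  rw [Finsupp.degree_eq_sum]
  simp [squarefreeExponent_apply]

theorem prod_X_eq_monomial (s : Finset (Fin n)) :
    (∏ j ∈ s, X j : MvPolynomial (Fin n) K) = monomial (squarefreeExponent s) 1 := by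
  have : squarefreeExponent s = ∑ j ∈ s, Finsupp.single j 1 := by
    ext j
    rw [squarefreeExponent_apply, Finsupp.finsetSum_apply]
    simp [Finsupp.single_apply]
  rw [this, monomial_sum_one]
  rfl

theorem sup_squarefreeExponent {α : Type*} (T : Finset α) (s : α → Finset (Fin n)) :
    T.sup (fun k => squarefreeExponent (s k)) = squarefreeExponent (T.sup s) := by
  refine le_antisymm (Finset.sup_le fun k hk => squarefreeExponent_le_iff.2 (Finset.le_sup hk)) ?_
  intro j
  rw [squarefreeExponent_apply]
  split_ifs with h
  · obtain ⟨k, hk, hj⟩ := Finset.mem_sup.1 h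
    have := (Finset.le_sup (f := fun k => squarefreeExponent (s k)) hk) j
    simpa [squarefreeExponent_apply, hj] using this
  · exact Nat.zero_le _

theorem monomialSpan_squarefreeExponent {α : Type*} (s : α → Finset (Fin n)) :
    monomialSpan (fun k => squarefreeExponent (s k)) K =
      Ideal.span (Set.range fun k => ∏ j ∈ s k, X j) := by
  rw [monomialSpan, ← Set.range_comp]
  simp only [prod_X_eq_monomial]
  rfl

theorem monomialSupp_prod_X (s : Finset (Fin n)) :
    monomialSupp (∏ j ∈ s, X j : MvPolynomial (Fin n) K) = s := by
  ext j
  constructor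
  · intro h
    obtain ⟨k, hk, hjk⟩ := (X_prime (R := K) (i := j)).exists_mem_finset_dvd h
    rw [X_dvd_X.1 hjk]
    exact hk
  · intro h
    exact Finset.dvd_prod_of_mem X h

end Squarefree

/-! ### Spread monomials and the upper bound -/

section Spread

variable {K : Type*} [Field K] {n : ℕ}

/-- A set of indices is `t`-spread if distinct elements differ by at least `t`. -/
def IsSpreadSet (t : ℕ) (s : Finset (Fin n)) : Prop :=
  ∀ a ∈ s, ∀ b ∈ s, a < b → (a : ℕ) + t ≤ b

/-- Monotonicity extends the gap condition from consecutive indices to all pairs, and `1 ≤ t` makes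
the indices distinct, so the product runs over a set. -/
theorem isSpreadMonomial_iff {t : ℕ} (ht : 1 ≤ t) {u : MvPolynomial (Fin n) K} :
    IsSpreadMonomial t u ↔ ∃ s : Finset (Fin n), IsSpreadSet t s ∧ u = ∏ j ∈ s, X j := by
  constructor
  · rintro ⟨d, i, hi, hspread, rfl⟩
    have hlt : ∀ j k : Fin d, j < k → (i j : ℕ) + t ≤ i k := by
      intro j k hjk
      have hjk' : (j : ℕ) < k := hjk
      have h1 := hspread j ⟨j + 1, by omega⟩ rfl
      have h2 : i ⟨j + 1, by omega⟩ ≤ i k := hi (show (j : ℕ) + 1 ≤ k from hjk')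
      exact h1.trans h2
    have hmono : StrictMono i := fun j k hjk => by
      have := hlt j k hjk
      rw [Fin.lt_def]; omega
    refine ⟨Finset.univ.image i, ?_, ?_⟩
    · intro a ha b hb hab
      obtain ⟨j, -, rfl⟩ := Finset.mem_image.1 ha
      obtain ⟨k, -, rfl⟩ := Finset.mem_image.1 hb
      exact hlt j k (hmono.lt_iff_lt.1 hab)
    · rw [Finset.prod_image hmono.injective.injOn]
  · rintro ⟨s, hs, rfl⟩
    refine ⟨s.card, s.orderEmbOfFin rfl, (s.orderEmbOfFin rfl).monotone, fun j k hjk => ?_, ?_⟩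
    · refine hs _ (Finset.orderEmbOfFin_mem _ _ _) _ (Finset.orderEmbOfFin_mem _ _ _) ?_
      rw [OrderEmbedding.lt_iff_lt, Fin.lt_def]
      omega
    · have h := Finset.prod_image (s := Finset.univ) (g := s.orderEmbOfFin rfl)
        (f := (X : Fin n → MvPolynomial (Fin n) K)) (s.orderEmbOfFin rfl).injective.injOn
      rw [Finset.image_orderEmbOfFin_univ] at h
      exact h

theorem isSpreadSet_one (s : Finset (Fin n)) : IsSpreadSet 1 s := fun _ _ _ _ hab => hab

theorem isSquarefreeMonomialIdeal_iff (I : Ideal (MvPolynomial (Fin n) K)) :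
    IsSquarefreeMonomialIdeal I ↔ IsSpreadIdeal 1 I := by
  constructor
  · rintro ⟨A, rfl⟩
    refine ⟨_, ?_, rfl⟩
    rintro _ ⟨s, -, rfl⟩
    exact (isSpreadMonomial_iff le_rfl).2 ⟨s, isSpreadSet_one s, rfl⟩
  · rintro ⟨G, hG, rfl⟩
    refine ⟨{s | ∏ j ∈ s, X j ∈ G}, congrArg _ ?_⟩
    ext u
    constructor
    · intro hu
      obtain ⟨s, -, rfl⟩ := (isSpreadMonomial_iff le_rfl).1 (hG u hu)
      exact ⟨s, hu, rfl⟩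
    · rintro ⟨s, hs, rfl⟩
      exact hs

/-- The union of `k` sets that are `t`-spread has at most `n - t + k` elements, since each of
them has at most one element among the last `t` indices. -/
theorem card_sup_le_of_isSpreadSet {α : Type*} {t : ℕ} (htn : t ≤ n) {s : α → Finset (Fin n)}
    (hs : ∀ k, IsSpreadSet t (s k)) (T : Finset α) : (T.sup s).card ≤ n - t + T.card := by
  classical
  rw [← Finset.card_filter_add_card_filter_not (s := T.sup s) fun j : Fin n => (j : ℕ) < n - t]
  refine add_le_add ?_ ?_
  · calc _ ≤ (Finset.range (n - t)).card := by
          refine Finset.card_le_card_of_injOn (fun j : Fin n => (j : ℕ)) ?_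
            Fin.val_injective.injOn
          intro j hj
          simpa using (Finset.mem_filter.1 hj).2
      _ = n - t := Finset.card_range _
  · have hsub : (T.sup s).filter (fun j : Fin n => ¬ (j : ℕ) < n - t) ⊆
        T.biUnion fun k => (s k).filter fun j : Fin n => ¬ (j : ℕ) < n - t := by
      intro j hj
      obtain ⟨hj1, hj2⟩ := Finset.mem_filter.1 hj
      obtain ⟨k, hk, hjk⟩ := Finset.mem_sup.1 hj1
      exact Finset.mem_biUnion.2 ⟨k, hk, Finset.mem_filter.2 ⟨hjk, hj2⟩⟩
    refine (Finset.card_le_card hsub).trans ?_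
    rw [← mul_one T.card]
    refine Finset.card_biUnion_le_card_mul _ _ _ fun k _ => Finset.card_le_one.2 ?_
    intro a ha b hb
    obtain ⟨ha1, ha2⟩ := Finset.mem_filter.1 ha
    obtain ⟨hb1, hb2⟩ := Finset.mem_filter.1 hb
    by_contra hab
    rcases lt_or_gt_of_ne hab with h | h
    · have := hs k a ha1 b hb1 h
      omega
    · have := hs k b hb1 a ha1 h
      omega

theorem degree_sup_squarefreeExponent_le {α : Type*} {t : ℕ} (htn : t ≤ n)
    {s : α → Finset (Fin n)} (hs : ∀ k, IsSpreadSet t (s k)) (T : Finset α) :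
    ((T.sup fun k => squarefreeExponent (s k)).degree : ℤ) - (T.card - 1) ≤
      (n : ℤ) - ((t : ℤ) - 1) := by
  have := card_sup_le_of_isSpreadSet htn hs T
  rw [sup_squarefreeExponent, degree_squarefreeExponent]
  omega

/-- A `t`-spread ideal has regularity at most `n - (t - 1)`. -/
theorem exists_hasRegularity_le_of_isSpreadIdeal {t : ℕ} (ht : 1 ≤ t) (htn : t ≤ n)
    {I : Ideal (MvPolynomial (Fin n) K)} (hI : IsSpreadIdeal t I) :
    ∃ r : WithBot ℤ, HasRegularity I r ∧ r ≤ (((n : ℤ) - ((t : ℤ) - 1) : ℤ) : WithBot ℤ) := by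
  classical
  obtain ⟨G, hG, rfl⟩ := hI
  -- There are only finitely many squarefree monomials; enumerating them by `Fin A.card` supplies
  -- the linear order behind the Taylor signs.
  let A : Finset (Finset (Fin n)) :=
    Finset.univ.filter fun s => IsSpreadSet t s ∧ (∏ j ∈ s, X j : MvPolynomial (Fin n) K) ∈ G
  have hA : ∀ s, s ∈ A ↔ IsSpreadSet t s ∧ (∏ j ∈ s, X j : MvPolynomial (Fin n) K) ∈ G :=
    fun s => by simp [A]
  let s : Fin A.card → Finset (Fin n) := fun k => A.equivFin.symm k
  have hs : ∀ k, s k ∈ A := fun k => (A.equivFin.symm k).2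
  have hG' : G = Set.range fun k => ∏ j ∈ s k, X j := by
    ext u
    constructor
    · intro hu
      obtain ⟨s', hs', rfl⟩ := (isSpreadMonomial_iff ht).1 (hG u hu)
      exact ⟨A.equivFin ⟨s', (hA s').2 ⟨hs', hu⟩⟩, by simp [s]⟩
    · rintro ⟨k, rfl⟩
      exact ((hA _).1 (hs k)).2
  rw [hG', ← monomialSpan_squarefreeExponent]
  exact exists_hasRegularity_le fun T _ =>
    degree_sup_squarefreeExponent_le htn (fun k => ((hA _).1 (hs k)).1) T

end Spread

/-! ### The Pascal ideal attains the bound -/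

section Pascal

variable {K : Type*} [Field K] {n t : ℕ}

/-- The support of the Pascal monomials. -/
def pascalSupport (n t i : ℕ) : Finset (Fin n) :=
  Finset.univ.filter fun j : Fin n => (j : ℕ) + 1 ≡ i [MOD t]

theorem mem_pascalSupport {i : ℕ} {j : Fin n} :
    j ∈ pascalSupport n t i ↔ (j : ℕ) + 1 ≡ i [MOD t] := by
  simp [pascalSupport]

theorem pascalMonomial_eq (i : ℕ) :
    pascalMonomial K n t i = ∏ j ∈ pascalSupport n t i, X j := rfl

/-- Distinct indices congruent modulo `t` differ by a nonzero multiple of `t`. -/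
theorem isSpreadSet_pascalSupport (i : ℕ) : IsSpreadSet t (pascalSupport n t i) := by
  intro a ha b hb hab
  rw [mem_pascalSupport] at ha hb
  have h : (a : ℕ) ≡ b [MOD t] := Nat.ModEq.add_right_cancel' 1 (ha.trans hb.symm)
  have hab' : (a : ℕ) < b := hab
  have := Nat.le_of_dvd (by omega) ((Nat.modEq_iff_dvd' hab'.le).1 h)
  omega

theorem eq_of_mem_pascalSupport {i i' : ℕ} {j : Fin n} (hi : i ∈ Set.Icc 1 t)
    (hi' : i' ∈ Set.Icc 1 t) (h : j ∈ pascalSupport n t i) (h' : j ∈ pascalSupport n t i') :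
    i = i' := by
  rw [mem_pascalSupport] at h h'
  -- Shifting by one moves `1, …, t` to the standard residues `0, …, t - 1`.
  have h2 : i - 1 ≡ i' - 1 [MOD t] := by
    refine Nat.ModEq.add_right_cancel' 1 ?_
    rw [Nat.sub_add_cancel hi.1, Nat.sub_add_cancel hi'.1]
    exact h.symm.trans h'
  have h3 := Nat.ModEq.eq_of_lt_of_lt h2 (by have := hi.1; have := hi.2; omega)
    (by have := hi'.1; have := hi'.2; omega)
  have := hi.1
  have := hi'.1
  omega

theorem exists_mem_pascalSupport (ht : 1 ≤ t) (j : Fin n) :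
    ∃ i ∈ Set.Icc 1 t, j ∈ pascalSupport n t i := by
  refine ⟨(j : ℕ) % t + 1, ⟨by omega, Nat.mod_lt _ ht⟩, ?_⟩
  rw [mem_pascalSupport]
  exact (Nat.mod_modEq _ _).symm.add_right 1

theorem exists_mem_of_mem_Icc (htn : t ≤ n) {i : ℕ} (hi : i ∈ Set.Icc 1 t) :
    ∃ j, j ∈ pascalSupport n t i := by
  have := hi.1
  have := hi.2
  refine ⟨⟨i - 1, by omega⟩, mem_pascalSupport.2 ?_⟩
  rw [Nat.sub_add_cancel hi.1]

theorem pascalMonomial_injOn (htn : t ≤ n) :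
    Set.InjOn (pascalMonomial K n t) (Set.Icc 1 t) := by
  intro i hi i' hi' h
  obtain ⟨j, hj⟩ := exists_mem_of_mem_Icc htn hi
  refine eq_of_mem_pascalSupport hi hi' hj ?_
  have h2 := congrArg monomialSupp h
  rw [pascalMonomial_eq, pascalMonomial_eq, monomialSupp_prod_X, monomialSupp_prod_X,
    Finset.coe_inj] at h2
  rwa [← h2]

theorem pascalIdeal_eq :
    pascalIdeal K n t =
      monomialSpan (fun k : Fin t => squarefreeExponent (pascalSupport n t (k + 1))) K := by
  rw [monomialSpan_squarefreeExponent, pascalIdeal, pascalGenerators]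
  congr 1
  ext u
  constructor
  · rintro ⟨i, hi, rfl⟩
    have := hi.1
    have := hi.2
    refine ⟨⟨i - 1, by omega⟩, ?_⟩
    simp only [Nat.sub_add_cancel hi.1]
    rfl
  · rintro ⟨k, rfl⟩
    exact ⟨k + 1, ⟨by omega, k.2⟩, rfl⟩

theorem hasRegularity_pascalIdeal (ht : 1 ≤ t) (htn : t ≤ n) :
    HasRegularity (pascalIdeal K n t) (((n : ℤ) - ((t : ℤ) - 1) : ℤ) : WithBot ℤ) := by
  have hmem : ∀ k : Fin t, (k : ℕ) + 1 ∈ Set.Icc 1 t := fun k => ⟨by omega, k.2⟩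
  rw [pascalIdeal_eq]
  refine hasRegularity_of_forall_not_le (fun T k hk h => ?_)
    (fun T _ => degree_sup_squarefreeExponent_le htn (fun _ => isSpreadSet_pascalSupport _) T)
    (T := Finset.univ) ⟨⟨0, ht⟩, Finset.mem_univ _⟩ ?_
  -- A variable of the generator `k` would occur in another generator, contradicting disjointness.
  · rw [sup_squarefreeExponent, squarefreeExponent_le_iff] at h
    obtain ⟨j, hj⟩ := exists_mem_of_mem_Icc htn (hmem k)
    obtain ⟨l, hl, hjl⟩ := Finset.mem_sup.1 (h hj)
    have := eq_of_mem_pascalSupport (hmem k) (hmem l) hj hjl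
    exact hk (Fin.ext (by omega : (k : ℕ) = l) ▸ hl)
  -- All `t` generators together involve every variable, so this face has degree `n` and gives `n -
  -- (t - 1)`.
  · have : (Finset.univ.sup fun k : Fin t => pascalSupport n t (k + 1)) = Finset.univ := by
      refine Finset.eq_univ_of_forall fun j => ?_
      obtain ⟨i, hi, hj⟩ := exists_mem_pascalSupport ht j
      have := hi.1
      have := hi.2
      refine Finset.mem_sup.2 ⟨⟨i - 1, by omega⟩, Finset.mem_univ _, ?_⟩
      simpa only [Nat.sub_add_cancel hi.1] using hj
    rw [sup_squarefreeExponent, this, degree_squarefreeExponent, Finset.card_univ,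
      Finset.card_univ, Fintype.card_fin, Fintype.card_fin]

end Pascal

theorem mainTheorem1 {K : Type*} [Field K] (n t : ℕ) (ht : 1 ≤ t) (htn : t ≤ n) :
    -- every `t`-spread ideal has regularity at most `n - (t - 1)`
    (∀ I : Ideal (MvPolynomial (Fin n) K), IsSpreadIdeal t I →
      ∃ r : WithBot ℤ, HasRegularity I r ∧ r ≤ (((n : ℤ) - ((t : ℤ) - 1) : ℤ) : WithBot ℤ)) ∧
    -- the case `t = 1`: squarefree ideals are the `1`-spread ideals, and have regularity at most `n`
    (∀ I : Ideal (MvPolynomial (Fin n) K), IsSquarefreeMonomialIdeal I ↔ IsSpreadIdeal 1 I) ∧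
    (∀ I : Ideal (MvPolynomial (Fin n) K), IsSquarefreeMonomialIdeal I →
      ∃ r : WithBot ℤ, HasRegularity I r ∧ r ≤ ((n : ℤ) : WithBot ℤ)) ∧
    -- the Pascal ideal is `t`-spread, generated by `t` monomials with disjoint supports
    -- that cover all the variables, and attains the bound
    (∀ u ∈ pascalGenerators K n t, IsSpreadMonomial t u) ∧
    (pascalGenerators K n t).ncard = t ∧
    (pascalGenerators K n t).PairwiseDisjoint monomialSupp ∧
    (⋃ u ∈ pascalGenerators K n t, monomialSupp u) = Set.univ ∧
    IsSpreadIdeal t (pascalIdeal K n t) ∧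
    HasRegularity (pascalIdeal K n t) (((n : ℤ) - ((t : ℤ) - 1) : ℤ) : WithBot ℤ) := by
  have hspread : ∀ u ∈ pascalGenerators K n t, IsSpreadMonomial t u := by
    rintro _ ⟨i, -, rfl⟩
    exact (isSpreadMonomial_iff ht).2 ⟨_, isSpreadSet_pascalSupport i, rfl⟩
  refine ⟨fun I hI => exists_hasRegularity_le_of_isSpreadIdeal ht htn hI,
    isSquarefreeMonomialIdeal_iff, fun I hI => ?_, hspread, ?_, ?_, ?_, ⟨_, hspread, rfl⟩,
    hasRegularity_pascalIdeal ht htn⟩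
  · simpa using exists_hasRegularity_le_of_isSpreadIdeal le_rfl (ht.trans htn)
      ((isSquarefreeMonomialIdeal_iff I).1 hI)
  · rw [pascalGenerators, Set.InjOn.ncard_image (pascalMonomial_injOn htn),
      ← Finset.coe_Icc, Set.ncard_coe_finset, Nat.card_Icc, Nat.add_sub_cancel]
  · rintro _ ⟨i, hi, rfl⟩ _ ⟨i', hi', rfl⟩ hne
    rw [Function.onFun, pascalMonomial_eq, pascalMonomial_eq, monomialSupp_prod_X,
      monomialSupp_prod_X, Finset.disjoint_coe, Finset.disjoint_left]
    intro j hj hj'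
    exact hne (congrArg _ (eq_of_mem_pascalSupport hi hi' hj hj'))
  · refine Set.eq_univ_of_forall fun j => ?_
    obtain ⟨i, hi, hj⟩ := exists_mem_pascalSupport ht j
    refine Set.mem_biUnion ⟨i, hi, rfl⟩ ?_
    rw [pascalMonomial_eq, monomialSupp_prod_X]
    exact hj
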